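/- For every integer $t \ge 1$ there is a constant $C_t$, depending only on $t$, such that the following holds for every integer $d \ge 1$. Let $\mu$ denote the Lebesgue (surface) measure on the unit sphere $S^{d-1} \subset \mathbb{R}^d$, normalized so that $\mu(S^{d-1}) = 1$. 1. There is a weighted spherical $t$-design on $S^{d-1}$ with at most $C_t\, d^{t-1}$ points; that is, there are a finite set $X \subseteq S^{d-1}$ with $|X| \le C_t\, d^{t-1}$ and a weight function $w \colon X \to \mathbb{R}_{>0}$ such that $$\sum_{x \in X} w(x)\, f(x) = \int_{S^{d-1}} f \, d\mu$$ for every real polynomial $f$ in $d$ variables of total degree at most $t$. 2. There is a nonempty finite multiset $X$ of points of $S^{d-1}$ that has at most $C_t\, d^{t-1}$ distinct points and is an unweighted spherical $t$-design; that is, $$\frac{1}{|X|} \sum_{x \in X} f(x) = \int_{S^{d-1}} f \, d\mu$$ for every real polynomial $f$ in $d$ variables of total degree at most $t$, where the sum and the cardinality $|X|$ count points with multiplicity. -/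

import Mathlib

open MeasureTheory

/-- The unit sphere `S^{d-1}` of `ℝ^d` with its Euclidean norm. -/
abbrev UnitSphere (d : ℕ) : Type :=
  Metric.sphere (0 : EuclideanSpace ℝ (Fin d)) 1

/-- The Lebesgue (surface) measure on `S^{d-1}`, normalized to have total mass `1` (for `1 ≤ d`). -/
noncomputable def sphereMeasure (d : ℕ) : Measure (UnitSphere d) :=
  ((volume : Measure (EuclideanSpace ℝ (Fin d))).toSphere Set.univ)⁻¹ •
    (volume : Measure (EuclideanSpace ℝ (Fin d))).toSphere

/-- The value at a point of the sphere of a real polynomial in `d` variables. -/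
noncomputable def polyValue {d : ℕ} (f : MvPolynomial (Fin d) ℝ) (x : UnitSphere d) : ℝ :=
  MvPolynomial.eval (fun i => (x : EuclideanSpace ℝ (Fin d)) i) f

/-- The finite set `X ⊆ S^{d-1}` with the weights `w x`, `x ∈ X`, is a weighted spherical
`t`-design. The values of `w` outside `X` play no role. -/
def IsWeightedSphericalDesign {d : ℕ} (t : ℕ) (X : Finset (UnitSphere d))
    (w : UnitSphere d → ℝ) : Prop :=
  (∀ x ∈ X, 0 < w x) ∧
  ∀ f : MvPolynomial (Fin d) ℝ, f.totalDegree ≤ t →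
    ∑ x ∈ X, w x * polyValue f x = ∫ x, polyValue f x ∂(sphereMeasure d)

/-- The nonempty finite multiset `X` of points of `S^{d-1}` is an unweighted spherical `t`-design;
the sum and the cardinality count points with multiplicity. -/
def IsUnweightedSphericalDesign {d : ℕ} (t : ℕ) (X : Multiset (UnitSphere d)) : Prop :=
  X ≠ 0 ∧
  ∀ f : MvPolynomial (Fin d) ℝ, f.totalDegree ≤ t →
    (1 / (Multiset.card X : ℝ)) * (X.map (polyValue f)).sum
      = ∫ x, polyValue f x ∂(sphereMeasure d)

/-!
A homogeneous polynomial of degree `k` has the same mean on the sphere and under the standard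
Gaussian measure, up to the factor `𝔼 ‖x‖ ^ k`, which does not depend on the polynomial. The
Gaussian measure is a product of copies of `gaussianReal 0 1`, whose moments are integers, so for
every large `p` there are `p` rational nodes (with repetition) whose average is exact for it up to
degree `t`. With `p` prime, placing these nodes along the rows of the orthogonal array of strength
`t` given by a dual BCH code over `ZMod p` yields `O(d ^ (t - 1))` rational vectors in `ℝ ^ d` whose
average is exact for the Gaussian measure up to degree `t`.

Projecting these vectors `v` to the sphere and weighting them by `‖v‖ ^ (2 * s)`, `s = ⌊t / 2⌋`,
gives a formula which is exact on even homogeneous polynomials of degree at most `2 * s`: multiply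
them by powers of `∑ i, X i ^ 2`, which is `1` on the sphere, to reach degree `2 * s`. Adding the
antipodes settles the odd degrees. The weights are rational because the vectors are and `2 * s` is
even, so clearing denominators turns them into multiplicities.
-/

section

open Polynomial ProbabilityTheory
open scoped NNReal

theorem exists_mem_openSegment_of_mem_interior {E : Type*} [AddCommGroup E] [Module ℝ E]
    [TopologicalSpace E] [IsTopologicalAddGroup E] [ContinuousSMul ℝ E] {s : Set E} {x : E}
    (hx : x ∈ interior s) (y : E) : ∃ z ∈ s, x ∈ openSegment ℝ z y := by
  have hlim : Filter.Tendsto (fun δ : ℝ => x + δ • (x - y)) (nhdsWithin 0 (Set.Ioi 0)) (nhds x) :=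
    tendsto_nhdsWithin_of_tendsto_nhds <| by
      simpa using (by fun_prop : Continuous fun δ : ℝ => x + δ • (x - y)).tendsto 0
  obtain ⟨δ, hδs, hδ⟩ := ((hlim.eventually (mem_interior_iff_mem_nhds.1 hx)).and
    self_mem_nhdsWithin).exists
  have hδ1 : 0 < 1 + δ := add_pos one_pos hδ
  refine ⟨_, hδs, 1 / (1 + δ), δ / (1 + δ), one_div_pos.2 hδ1, div_pos hδ hδ1, by field_simp, ?_⟩
  match_scalars <;> field_simp
  ring

theorem integral_mem_interior_convexHull {Ω E : Type*} [TopologicalSpace Ω] [MeasurableSpace Ω]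
    [OpensMeasurableSpace Ω] [NormedAddCommGroup E] [NormedSpace ℝ E] [FiniteDimensional ℝ E]
    {μ : Measure Ω} [IsProbabilityMeasure μ] [μ.IsOpenPosMeasure] {φ : Ω → E}
    (hφ : Continuous φ) (hint : Integrable φ μ) {D : Set Ω} (hD : Dense D)
    (hspan : affineSpan ℝ (φ '' D) = ⊤) :
    ∫ x, φ x ∂μ ∈ interior (convexHull ℝ (φ '' D)) := by
  set C := convexHull ℝ (φ '' D)
  have hC : Convex ℝ C := convex_convexHull ℝ _
  have hne : (interior C).Nonempty := interior_convexHull_nonempty_iff_affineSpan_eq_top.2 hspan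
  by_contra hb
  obtain ⟨f, hf⟩ := geometric_hahn_banach_open_point hC.interior isOpen_interior hb
  have hle : ∀ x, f (φ x) ≤ f (∫ x, φ x ∂μ) := by
    have hclosure : closure C ⊆ {y | f y ≤ f (∫ x, φ x ∂μ)} := by
      rw [← hC.closure_interior_eq_closure_of_nonempty_interior hne]
      exact closure_minimal (fun y hy => (hf y hy).le) (isClosed_le f.continuous continuous_const)
    have hDle : Set.MapsTo φ D (closure C) := fun x hx =>
      subset_closure (subset_convexHull ℝ _ (Set.mem_image_of_mem φ hx))
    exact fun x => hclosure (isClosed_closure.closure_subset (hDle.closure hφ (hD x)))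
  have heq : (fun x => f (φ x)) = fun _ => f (∫ x, φ x ∂μ) := by
    refine Measure.eq_of_ae_eq (μ := μ) ?_ (by fun_prop) continuous_const
    rw [← integral_eq_iff_of_ae_le (f.integrable_comp hint) (integrable_const _) (.of_forall hle),
      f.integral_comp_comm hint]
    simp
  have hCeq : C ⊆ {y | f y = f (∫ x, φ x ∂μ)} := by
    refine convexHull_min ?_ (convex_hyperplane f.toLinearMap.isLinear _)
    rintro _ ⟨x, -, rfl⟩
    exact congrFun heq x
  obtain ⟨y, hy⟩ := hne
  exact (hf y hy).ne (hCeq (interior_subset hy))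

/-- The curve `x ↦ (x, x ^ 2, …, x ^ t)`. Convex combinations of its points are the moment vectors
of finitely supported probability measures. -/
def momentCurve (t : ℕ) (x : ℝ) : Fin t → ℝ := fun j => x ^ (j.1 + 1)

theorem continuous_momentCurve (t : ℕ) : Continuous (momentCurve t) := by
  unfold momentCurve
  fun_prop

theorem exists_eval_eq_coeff_zero_add_momentCurve {t : ℕ} {f : ℝ[X]} (hf : f.natDegree ≤ t) :
    ∃ Λ : (Fin t → ℝ) →L[ℝ] ℝ, ∀ x, f.eval x = f.coeff 0 + Λ (momentCurve t x) := by
  refine ⟨∑ j : Fin t, f.coeff (j + 1) • ContinuousLinearMap.proj j, fun x => ?_⟩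
  rw [f.eval_eq_sum_range' (Nat.lt_succ_of_le hf), Finset.sum_range_succ', add_comm, pow_zero,
    mul_one, ← Fin.sum_univ_eq_sum_range fun j => f.coeff (j + 1) * x ^ (j + 1)]
  simp [momentCurve]

theorem affineSpan_momentCurve_image_eq_top (t : ℕ) {D : Set ℝ} (hD : D.Infinite) :
    affineSpan ℝ (momentCurve t '' D) = ⊤ := by
  obtain ⟨a, ha⟩ := hD.nonempty
  rw [AffineSubspace.affineSpan_eq_top_iff_vectorSpan_eq_top_of_nonempty ℝ _ _
    ⟨_, Set.mem_image_of_mem _ ha⟩]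
  by_contra hne
  obtain ⟨Λ, hΛ, hker⟩ := Submodule.exists_le_ker_of_lt_top _ (lt_top_iff_ne_top.2 hne)
  obtain ⟨c, hc⟩ : ∃ c : Fin t → ℝ, ∀ v, Λ v = ∑ j, v j * c j := ⟨_, Λ.pi_apply_eq_sum_univ⟩
  set f : ℝ[X] := ∑ j : Fin t, C (c j) * X ^ (j.1 + 1) with hf
  have heval : ∀ x, f.eval x = Λ (momentCurve t x) := fun x => by
    simp only [hf, eval_finsetSum, hc, eval_mul, eval_C, eval_pow, eval_X, momentCurve, mul_comm]
  have hconst : f = C (Λ (momentCurve t a)) := by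
    refine eq_of_infinite_eval_eq _ _ (hD.mono fun x hx => ?_)
    have : momentCurve t x -ᵥ momentCurve t a ∈ LinearMap.ker Λ :=
      hker (vsub_mem_vectorSpan ℝ (Set.mem_image_of_mem _ hx) (Set.mem_image_of_mem _ ha))
    simpa [heval, sub_eq_zero] using this
  have hc0 : ∀ j, c j = 0 := fun j => by
    simpa [hf, coeff_X_pow, Fin.val_inj, coeff_C] using congrArg (coeff · (j.1 + 1)) hconst
  exact hΛ (LinearMap.ext fun v => by simp [hc, hc0])

theorem exists_quadrature_with_prescribed_nodes {μ : Measure ℝ} [IsProbabilityMeasure μ]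
    [μ.IsOpenPosMeasure] (hμ : ∀ j : ℕ, Integrable (fun x => x ^ j) μ) (t : ℕ) {D : Set ℝ}
    (hD : Dense D) (hDinf : D.Infinite) {κ : Type*} [Fintype κ] [Nonempty κ] (y : κ → ℝ) :
    ∃ (ι : Type) (_ : Fintype ι) (x w : ι → ℝ) (ε : ℝ), (∀ i, x i ∈ D) ∧ (∀ i, 0 ≤ w i) ∧ 0 < ε ∧
      ∀ f : ℝ[X], f.natDegree ≤ t →
        ∫ z, f.eval z ∂μ = ∑ i, w i * f.eval (x i) + ε * ∑ k, f.eval (y k) := by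
  have hint : Integrable (momentCurve t) μ := Integrable.of_eval fun j => hμ _
  obtain ⟨z, hz, a, b, ha, hb, hab, hm⟩ := exists_mem_openSegment_of_mem_interior
    (integral_mem_interior_convexHull (continuous_momentCurve t) hint hD
      (affineSpan_momentCurve_image_eq_top t hDinf))
    ((Fintype.card κ : ℝ)⁻¹ • ∑ k, momentCurve t (y k))
  obtain ⟨ι, _, w, φ, hw, hw1, hφ, rfl⟩ := mem_convexHull_iff_exists_fintype.1 hz
  choose x hxD hxφ using hφ
  obtain rfl : φ = fun i => momentCurve t (x i) := funext fun i => (hxφ i).symm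
  have hκ : (Fintype.card κ : ℝ) ≠ 0 := by exact_mod_cast Fintype.card_ne_zero
  refine ⟨ι, inferInstance, x, fun i => a * w i, b / Fintype.card κ, hxD,
    fun i => mul_nonneg ha.le (hw i), by positivity, fun f hf => ?_⟩
  obtain ⟨Λ, hΛ⟩ := exists_eval_eq_coeff_zero_add_momentCurve hf
  have hΛm := congrArg Λ hm
  simp only [map_add, map_smul, map_sum, smul_eq_mul] at hΛm
  simp only [hΛ]
  rw [integral_add (integrable_const _) (Λ.integrable_comp hint), Λ.integral_comp_comm hint,
    ← hΛm]
  simp only [integral_const, probReal_univ, one_smul, mul_add, Finset.sum_add_distrib,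
    Finset.sum_const, Finset.card_univ, nsmul_eq_mul, mul_assoc, ← Finset.mul_sum]
  simp only [← Finset.sum_mul, hw1]
  field_simp
  linear_combination -(Fintype.card κ * f.coeff 0) * hab

theorem exists_nat_mul_eq_intCast {ι : Type*} [Finite ι] (q : ι → ℚ) :
    ∃ D : ℕ, D ≠ 0 ∧ ∀ i, ∃ z : ℤ, D * q i = z := by
  classical
  have := Fintype.ofFinite ι
  refine ⟨∏ i, (q i).den, Finset.prod_ne_zero_iff.2 fun i _ => (q i).den_ne_zero, fun i => ?_⟩
  obtain ⟨c, hc⟩ := Finset.dvd_prod_of_mem (fun i => (q i).den) (Finset.mem_univ i)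
  refine ⟨c * (q i).num, ?_⟩
  rw [hc]
  push_cast
  rw [mul_right_comm, Rat.den_mul_eq_num, mul_comm]

theorem lagrange_basis_div {F ι : Type*} [Field F] [DecidableEq ι] (s : Finset ι) (v : ι → F)
    (i : ι) {c : F} (hc : c ≠ 0) :
    Lagrange.basis s (fun j => v j / c) i = (Lagrange.basis s v i).comp (C c * X) := by
  rw [Lagrange.basis, Lagrange.basis, prod_comp]
  refine Finset.prod_congr rfl fun j _ => ?_
  have hcv : (C (v j) : F[X]) = C c * C (v j / c) := by rw [← C_mul, mul_div_cancel₀ _ hc]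
  rw [Lagrange.basisDivisor, Lagrange.basisDivisor, ← sub_div, inv_div, mul_comp, sub_comp, C_comp,
    X_comp, C_comp, hcv, ← mul_sub, ← mul_assoc, ← C_mul, inv_mul_eq_div]

theorem sum_mul_eval_lagrange_basis {F ι : Type*} [Field F] [DecidableEq ι] {s : Finset ι}
    {v : ι → F} (hv : Set.InjOn v s) {i : ι} (hi : i ∈ s) (c : ι → F) :
    ∑ j ∈ s, c j * (Lagrange.basis s v i).eval (v j) = c i := by
  rw [Finset.sum_eq_single_of_mem i hi, Lagrange.eval_basis_self hv hi, mul_one]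
  intro j hj hji
  rw [Lagrange.eval_basis_of_ne hji.symm hj, mul_zero]

theorem linearMap_eq_of_eq_lagrange_basis {F ι M : Type*} [Field F] [DecidableEq ι]
    [AddCommMonoid M] [Module F M] {Φ Ψ : F[X] →ₗ[F] M} {s : Finset ι} {v : ι → F}
    (hv : Set.InjOn v s) (h : ∀ i ∈ s, Φ (Lagrange.basis s v i) = Ψ (Lagrange.basis s v i))
    {f : F[X]} (hf : f.degree < s.card) : Φ f = Ψ f := by
  rw [Lagrange.eq_interpolate hv hf, Lagrange.interpolate_apply, map_sum, map_sum]
  refine Finset.sum_congr rfl fun i hi => ?_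
  rw [← smul_eq_C_mul, map_smul, map_smul, h i hi]

theorem exists_nodes_map_lagrange_basis_eq_intCast (L : ℚ[X] →ₗ[ℚ] ℚ) (hL : L 1 = 1) (t : ℕ) :
    ∃ y : Fin (t + 1) → ℚ, Function.Injective y ∧
      ∀ k, ∃ m : ℤ, L (Lagrange.basis Finset.univ y k) = m := by
  set v : Fin (t + 1) → ℚ := fun k => k.1
  have hv : Function.Injective v := Nat.cast_injective.comp Fin.val_injective
  set ℓ := Lagrange.basis Finset.univ v
  have hdeg : ∀ k, (ℓ k).natDegree = t := fun k => by
    simpa using Lagrange.natDegree_basis (v := v) hv.injOn (Finset.mem_univ k)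
  have hzero : ∀ k, (ℓ k).coeff 0 = if k = 0 then 1 else 0 := fun k => by
    have hv0 : v 0 = 0 := Nat.cast_zero
    rw [coeff_zero_eq_eval_zero]
    split_ifs with hk
    · rw [hk, ← hv0, Lagrange.eval_basis_self hv.injOn (Finset.mem_univ 0)]
    · simpa only [hv0] using Lagrange.eval_basis_of_ne (v := v) hk (Finset.mem_univ 0)
  have hmonomial : ∀ j c, L (monomial j c) = c * L (X ^ j) := fun j c => by
    rw [← C_mul_X_pow_eq_monomial, ← smul_eq_C_mul, map_smul, smul_eq_mul]
  obtain ⟨D, hD, hDint⟩ := exists_nat_mul_eq_intCast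
    fun kj : Fin (t + 1) × Fin t => (ℓ kj.1).coeff (kj.2 + 1) * L (X ^ (kj.2.1 + 1))
  choose z hz using hDint
  have hD' : (D : ℚ) ≠ 0 := by exact_mod_cast hD
  refine ⟨fun k => v k / D, fun i j h => hv ((div_left_inj' hD').1 h), fun k =>
    ⟨∑ j : Fin t, D ^ j.1 * z (k, j) + if k = 0 then 1 else 0, ?_⟩⟩
  -- Shrinking the nodes by `D` multiplies the coefficient of `X ^ j` by `D ^ j`, and the constant
  -- coefficient is an integer because `0` is a node.
  calc L (Lagrange.basis Finset.univ (fun k => v k / D) k)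
      = ∑ j ∈ Finset.range (t + 1), (ℓ k).coeff j * D ^ j * L (X ^ j) := by
        rw [lagrange_basis_div _ _ _ hD', as_sum_range' ((ℓ k).comp _) (t + 1), map_sum]
        · simp only [hmonomial, comp_C_mul_X_coeff, ℓ]
        · rw [natDegree_comp, natDegree_C_mul_X _ hD', mul_one, hdeg]
          exact t.lt_succ_self
    _ = ∑ j : Fin t, (ℓ k).coeff (j + 1) * D ^ (j.1 + 1) * L (X ^ (j.1 + 1)) +
          if k = 0 then 1 else 0 := by
        rw [Finset.sum_range_succ', hzero, pow_zero, pow_zero, hL, mul_one, mul_one,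
          Fin.sum_univ_eq_sum_range fun j => (ℓ k).coeff (j + 1) * D ^ (j + 1) * L (X ^ (j + 1))]
    _ = _ := by
        push_cast
        simp only [← hz]
        exact congrArg (· + _) (Finset.sum_congr rfl fun j _ => by ring)

theorem eventually_exists_natCast_combination {ι κ : Type*} [Fintype ι] [Finite κ]
    (a : ι → κ → ℚ) {w : ι → ℝ} (hw : ∀ i, 0 ≤ w i) (m : κ → ℤ) {ε : ℝ} (hε : 0 < ε)
    (h : ∀ k, (m k : ℝ) = ∑ i, w i * a i k + ε) :
    ∀ᶠ p : ℕ in Filter.atTop, ∃ (n : ι → ℕ) (u : κ → ℕ),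
      ∀ k, (p * m k : ℚ) = ∑ i, n i * a i k + u k := by
  obtain ⟨D, hD, hDint⟩ := exists_nat_mul_eq_intCast fun ik : ι × κ => a ik.1 ik.2
  choose z hz using hDint
  have hlarge : ∀ k, ∀ᶠ p : ℕ in Filter.atTop, ∑ i, D * |(a i k : ℝ)| ≤ p * ε := fun k =>
    (tendsto_natCast_atTop_atTop.atTop_mul_const hε).eventually_ge_atTop _
  filter_upwards [Filter.eventually_all.2 hlarge] with p hp
  -- Rounding `p * w i` down to a multiple of `D` costs a bounded error, absorbed by `p * ε` for
  -- large `p`.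
  set n : ι → ℕ := fun i => ⌊p * w i / D⌋₊
  have hD' : (0 : ℝ) < D := by positivity
  have hround : ∀ i k, -(D * |(a i k : ℝ)|) ≤ (p * w i - n i * D) * a i k := fun i k => by
    have h0 : 0 ≤ p * w i - n i * D :=
      sub_nonneg.2 ((le_div_iff₀ hD').1 (Nat.floor_le (by have := hw i; positivity)))
    have h1 : p * w i - n i * D ≤ D := by
      have := (div_lt_iff₀ hD').1 (Nat.lt_floor_add_one (p * w i / D : ℝ))
      linarith
    calc -(D * |(a i k : ℝ)|) ≤ -|(p * w i - n i * D) * a i k| := by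
          rw [abs_mul, abs_of_nonneg h0]
          gcongr
      _ ≤ _ := neg_abs_le _
  have hnonneg : ∀ k, 0 ≤ p * m k - ∑ i, n i * z (i, k) := fun k => by
    have hz' : ∀ i, (z (i, k) : ℝ) = D * a i k := fun i => by exact_mod_cast (hz (i, k)).symm
    have : (0 : ℝ) ≤ p * m k - ∑ i, n i * (z (i, k) : ℝ) := calc
      (0 : ℝ) ≤ ∑ i, -(D * |(a i k : ℝ)|) + p * ε := by
        rw [Finset.sum_neg_distrib]
        linarith [hp k]
      _ ≤ ∑ i, (p * w i - n i * D) * a i k + p * ε := by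
        gcongr with i
        exact hround i k
      _ = _ := by
        simp only [h, hz', mul_add, Finset.mul_sum, sub_mul, Finset.sum_sub_distrib, mul_assoc]
        ring
    exact_mod_cast this
  refine ⟨fun i => n i * D, fun k => (p * m k - ∑ i, n i * z (i, k)).toNat, fun k => ?_⟩
  rw [← Int.cast_natCast (Int.toNat _), Int.toNat_of_nonneg (hnonneg k)]
  push_cast
  simp only [← hz (_, k), mul_assoc]
  ring

theorem exists_sum_comp_eq_sum_nsmul {A ι α M : Type*} [Fintype A] [Fintype ι] [AddCommMonoid M]
    {n : ι → ℕ} (hn : ∑ i, n i = Fintype.card A) (z : ι → α) :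
    ∃ g : A → α, ∀ F : α → M, ∑ a, F (g a) = ∑ i, n i • F (z i) := by
  let e : A ≃ Σ i, Fin (n i) := Fintype.equivOfCardEq (by simp [hn])
  refine ⟨fun a => z (e a).1, fun F => ?_⟩
  rw [e.sum_comp fun s => F (z s.1), Fintype.sum_sigma]
  simp

theorem exists_momentFunctional {μ : Measure ℝ} (hμ : ∀ j : ℕ, Integrable (fun x => x ^ j) μ)
    (hrat : ∀ j : ℕ, ∃ q : ℚ, ∫ x, x ^ j ∂μ = q) :
    ∃ L : ℚ[X] →ₗ[ℚ] ℚ, ∀ f, (L f : ℝ) = ∫ x, aeval x f ∂μ := by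
  choose r hr using hrat
  refine ⟨(basisMonomials ℚ).constr ℚ r, fun f => ?_⟩
  have hint : ∀ f : ℚ[X], Integrable (fun x : ℝ => aeval x f) μ := fun f => by
    simp only [aeval_eq_sum_range]
    exact integrable_finsetSum _ fun j _ => (hμ j).smul (f.coeff j)
  induction f using Polynomial.induction_on' with
  | add f g hf hg => simp only [map_add, Rat.cast_add, hf, hg, integral_add (hint f) (hint g)]
  | monomial j c =>
    have : (basisMonomials ℚ).constr ℚ r (monomial j 1) = r j := by
      simpa using (basisMonomials ℚ).constr_basis ℚ r j
    rw [← mul_one c, ← smul_eq_mul, ← smul_monomial, map_smul, this]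
    simp only [map_smul, aeval_monomial, integral_smul]
    simp [hr, Rat.smul_def]

theorem exists_nat_weight_quadrature {μ : Measure ℝ} [IsProbabilityMeasure μ]
    [μ.IsOpenPosMeasure] (hμ : ∀ j : ℕ, Integrable (fun x => x ^ j) μ) {L : ℚ[X] →ₗ[ℚ] ℚ}
    (hL : ∀ f, (L f : ℝ) = ∫ x, aeval x f ∂μ) (t : ℕ) :
    ∃ (ι : Type) (_ : Fintype ι) (q : ι → ℚ), ∀ᶠ p : ℕ in Filter.atTop, ∃ n : ι → ℕ,
      ∀ f : ℚ[X], f.natDegree ≤ t → p * L f = ∑ i, n i * f.eval (q i) := by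
  have hL1 : L 1 = 1 := by exact_mod_cast (by simp [hL] : (L 1 : ℝ) = 1)
  obtain ⟨y, hy, hint⟩ := exists_nodes_map_lagrange_basis_eq_intCast L hL1 t
  choose m hm using hint
  set ℓ := Lagrange.basis Finset.univ y with hℓ
  obtain ⟨ι, _, x, w, ε, hx, hw, hε, hquad⟩ := exists_quadrature_with_prescribed_nodes hμ t
    Rat.denseRange_cast (Set.infinite_range_of_injective Rat.cast_injective) fun k => (y k : ℝ)
  choose q hq using hx
  obtain rfl : (fun i => (q i : ℝ)) = x := funext hq
  have hmquad : ∀ k, (m k : ℝ) = ∑ i, w i * ((ℓ k).eval (q i) : ℚ) + ε := fun k => by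
    have hdeg : (ℓ k).natDegree = t := by
      simpa using Lagrange.natDegree_basis hy.injOn (Finset.mem_univ k)
    have hcast : ∀ z : ℚ, aeval (z : ℝ) (ℓ k) = ((ℓ k).eval z : ℚ) := fun z =>
      aeval_algebraMap_apply_eq_algebraMap_eval z (ℓ k)
    have hsum : ∑ j, (ℓ k).eval (y j) = 1 := by
      simpa using sum_mul_eval_lagrange_basis hy.injOn (Finset.mem_univ k) 1
    have h := hquad ((ℓ k).map (algebraMap ℚ ℝ)) (by rw [natDegree_map, hdeg])
    simp only [eval_map_algebraMap, ← hL, hm, hcast] at h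
    rw [← Rat.cast_sum, hsum, Rat.cast_one, mul_one] at h
    exact h
  refine ⟨ι ⊕ Fin (t + 1), inferInstance, Sum.elim q y, ?_⟩
  filter_upwards [eventually_exists_natCast_combination (fun i k => (ℓ k).eval (q i)) hw m hε
    hmquad] with p ⟨n, u, hnu⟩
  refine ⟨Sum.elim n u, fun f hf => ?_⟩
  have hdeg : f.degree < (Finset.univ : Finset (Fin (t + 1))).card := by
    simpa using (degree_le_of_natDegree_le hf).trans_lt (by exact_mod_cast t.lt_succ_self)
  have hagree := linearMap_eq_of_eq_lagrange_basis (Φ := (p : ℚ) • L)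
    (Ψ := ∑ i, (n i : ℚ) • leval (q i) + ∑ k, (u k : ℚ) • leval (y k)) hy.injOn
    (fun k hk => by
      have hu := sum_mul_eval_lagrange_basis hy.injOn hk fun j => (u j : ℚ)
      simpa [← hℓ, hm, hnu] using hu.symm) hdeg
  simpa using hagree

theorem exists_equal_weight_quadrature {μ : Measure ℝ} [IsProbabilityMeasure μ]
    [μ.IsOpenPosMeasure] (hμ : ∀ j : ℕ, Integrable (fun x => x ^ j) μ)
    (hrat : ∀ j : ℕ, ∃ q : ℚ, ∫ x, x ^ j ∂μ = q) (t : ℕ) :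
    ∃ N : ℕ, ∀ (A : Type) [Fintype A], N ≤ Fintype.card A → ∃ g : A → ℚ,
      ∀ j ≤ t, ∑ a, (g a : ℝ) ^ j = Fintype.card A * ∫ x, x ^ j ∂μ := by
  obtain ⟨L, hL⟩ := exists_momentFunctional hμ hrat
  obtain ⟨ι, _, q, hq⟩ := exists_nat_weight_quadrature hμ hL t
  obtain ⟨N, hN⟩ := Filter.eventually_atTop.1 hq
  refine ⟨N, fun A _ hA => ?_⟩
  obtain ⟨n, hn⟩ := hN _ hA
  have hmoment : ∀ j, ∫ x, x ^ j ∂μ = L (X ^ j) := fun j => by simp [hL]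
  have hcard : ∑ i, n i = Fintype.card A := by
    have hL1 : L 1 = 1 := by exact_mod_cast (by simp [hL] : (L 1 : ℝ) = 1)
    have := hn 1 (by simp)
    simp only [hL1, eval_one, mul_one] at this
    exact_mod_cast this.symm
  obtain ⟨g, hg⟩ := exists_sum_comp_eq_sum_nsmul (M := ℚ) hcard q
  refine ⟨g, fun j hj => ?_⟩
  rw [hmoment]
  have := hn (X ^ j) (by simpa using hj)
  simp only [eval_pow, eval_X, ← nsmul_eq_mul, ← hg (· ^ j)] at this
  rw [nsmul_eq_mul] at this
  exact_mod_cast this.symm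

theorem hasDerivAt_gaussianPDFReal (μ : ℝ) (v : ℝ≥0) (x : ℝ) :
    HasDerivAt (gaussianPDFReal μ v) (-((x - μ) / v) * gaussianPDFReal μ v x) x := by
  have h : HasDerivAt (fun x => -(x - μ) ^ 2 / (2 * v)) (-((x - μ) / v)) x := by
    convert! (((hasDerivAt_id x).sub_const μ).pow 2).neg.div_const (2 * v : ℝ) using 1
    rcases eq_or_ne (v : ℝ) 0 with hv | hv
    · simp [hv]
    · field_simp
      simp [mul_comm]
  convert! h.exp.const_mul (√(2 * Real.pi * v))⁻¹ using 1
  rw [gaussianPDFReal]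
  ring

theorem integrable_pow_gaussianReal (v : ℝ≥0) (j : ℕ) :
    Integrable (fun x => x ^ j) (gaussianReal 0 v) := by
  refine (integrable_norm_iff (by fun_prop)).1 ?_
  simpa using (memLp_id_gaussianReal (μ := 0) (v := v) j).integrable_norm_pow'

theorem integral_pow_add_two_gaussianReal (v : ℝ≥0) (j : ℕ) :
    ∫ x, x ^ (j + 2) ∂gaussianReal 0 v = (j + 1) * v * ∫ x, x ^ j ∂gaussianReal 0 v := by
  rcases eq_or_ne v 0 with rfl | hv
  · simp
  have hv' : (v : ℝ) ≠ 0 := by exact_mod_cast hv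
  have hint : ∀ k : ℕ, Integrable fun x => gaussianPDFReal 0 v x * x ^ k := fun k => by
    have := integrable_pow_gaussianReal v k
    rw [gaussianReal, if_neg hv, integrable_withDensity_iff_integrable_smul'
      (measurable_gaussianPDF _ _) (ae_of_all _ fun _ => gaussianPDF_lt_top)] at this
    simpa using this
  have hparts := integral_mul_deriv_eq_deriv_mul_of_integrable (u := fun x => x ^ (j + 1))
    (u' := fun x => (j + 1 : ℕ) * x ^ j) (v := gaussianPDFReal 0 v)
    (v' := fun x => -((x - 0) / v) * gaussianPDFReal 0 v x)
    (fun x _ => by simpa using hasDerivAt_pow (j + 1) x)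
    (fun x _ => hasDerivAt_gaussianPDFReal 0 v x)
    (((hint (j + 2)).div_const (-(v : ℝ))).congr (.of_forall fun x => by
      simp only [Pi.mul_apply]
      field_simp
      ring))
    (((hint j).const_mul (j + 1 : ℝ)).congr (.of_forall fun x => by
      simp only [Pi.mul_apply, Nat.cast_succ]
      ring))
    ((hint (j + 1)).congr (.of_forall fun x => mul_comm _ _))
  simp only [integral_gaussianReal_eq_integral_smul hv, smul_eq_mul, ← integral_const_mul]
  have hneg : ∫ x, gaussianPDFReal 0 v x * x ^ (j + 2) =
      -v * ∫ x, x ^ (j + 1) * (-((x - 0) / v) * gaussianPDFReal 0 v x) := by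
    rw [← integral_const_mul]
    refine integral_congr_ae (.of_forall fun x => ?_)
    simp only
    field_simp
    ring
  rw [hneg, hparts, neg_mul_neg, ← integral_const_mul]
  refine integral_congr_ae (.of_forall fun x => ?_)
  push_cast
  ring

theorem exists_nat_eq_integral_pow_gaussianReal (j : ℕ) :
    ∃ n : ℕ, ∫ x, x ^ j ∂gaussianReal 0 1 = n := by
  induction j using Nat.twoStepInduction with
  | zero => exact ⟨1, by simp⟩
  | one => exact ⟨0, by simp⟩
  | more j hj _ =>
    obtain ⟨n, hn⟩ := hj
    exact ⟨(j + 1) * n, by simp [integral_pow_add_two_gaussianReal, hn]⟩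

theorem stdGaussian_eq_withDensity (E : Type*) [NormedAddCommGroup E] [InnerProductSpace ℝ E]
    [FiniteDimensional ℝ E] [MeasurableSpace E] [BorelSpace E] :
    stdGaussian E = volume.withDensity fun x => ENNReal.ofReal
      ((2 * Real.pi) ^ (-(Module.finrank ℝ E / 2 : ℝ)) * Real.exp (-(1 / 2) * ‖x‖ ^ 2)) := by
  set c := (2 * Real.pi) ^ (-(Module.finrank ℝ E / 2 : ℝ)) with hc
  have hint : Integrable fun x : E => c * Real.exp (-(1 / 2) * ‖x‖ ^ 2) := by
    have h := GaussianFourier.integrable_cexp_neg_mul_sq_norm_add (V := E) (b := 1 / 2)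
      (by norm_num) 0 0
    refine (h.re.congr (.of_forall fun x => ?_)).const_mul c
    simp [← Complex.ofReal_pow, Complex.exp_re, ← Complex.ofReal_ofNat, ← Complex.ofReal_inv]
  have : IsFiniteMeasure (volume.withDensity fun x : E =>
      ENNReal.ofReal (c * Real.exp (-(1 / 2) * ‖x‖ ^ 2))) :=
    isFiniteMeasure_withDensity_ofReal hint.2
  refine Measure.ext_of_charFun (funext fun y => ?_)
  have hgauss := GaussianFourier.integral_cexp_neg_mul_sq_norm_add (V := E) (b := 1 / 2)
    (by norm_num) Complex.I y
  have hconst : (c : ℂ) * (Real.pi / (1 / 2)) ^ (Module.finrank ℝ E / 2 : ℂ) = 1 := by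
    have h2pi : (Real.pi / (1 / 2) : ℂ) = (2 * Real.pi : ℝ) := by push_cast; ring
    have hexp : (Module.finrank ℝ E / 2 : ℂ) = (Module.finrank ℝ E / 2 : ℝ) := by push_cast; ring
    rw [h2pi, hexp, ← Complex.ofReal_cpow Real.two_pi_pos.le, ← Complex.ofReal_mul, hc,
      ← Real.rpow_add Real.two_pi_pos, neg_add_cancel, Real.rpow_zero, Complex.ofReal_one]
  calc charFun (stdGaussian E) y
      = c * ∫ x : E, Complex.exp (-(1 / 2) * ‖x‖ ^ 2 + Complex.I * inner ℝ y x) := by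
        rw [hgauss, charFun_stdGaussian, ← mul_assoc, hconst, one_mul, Complex.I_sq]
        congr 1
        ring
    _ = charFun (volume.withDensity fun x : E =>
          ENNReal.ofReal (c * Real.exp (-(1 / 2) * ‖x‖ ^ 2))) y := by
        rw [charFun_apply, integral_withDensity_eq_integral_toReal_smul
          (by fun_prop) (by simp), ← integral_const_mul]
        refine integral_congr_ae (.of_forall fun x => ?_)
        simp only
        rw [ENNReal.toReal_ofReal (by positivity), Complex.real_smul, Complex.exp_add,
          real_inner_comm, mul_comm Complex.I]
        push_cast
        ring

theorem integral_mul_fun_norm_of_homogeneous {E : Type*} [NormedAddCommGroup E]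
    [NormedSpace ℝ E] [Nontrivial E] [FiniteDimensional ℝ E] [MeasurableSpace E] [BorelSpace E]
    (μ : Measure E) [μ.IsAddHaarMeasure] {F : E → ℝ} {k : ℕ}
    (hF : ∀ r : ℝ, 0 < r → ∀ x, F (r • x) = r ^ k * F x) (w : ℝ → ℝ) :
    ∫ x, F x * w ‖x‖ ∂μ = (∫ x, ‖x‖ ^ k * w ‖x‖ ∂μ) *
      ⨍ u : Metric.sphere (0 : E) 1, F u ∂μ.toSphere := by
  have hpolar : ∀ G : E → ℝ, (∀ r : ℝ, 0 < r → ∀ x, G (r • x) = r ^ k * G x) →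
      ∫ x, G x * w ‖x‖ ∂μ = (∫ u : Metric.sphere (0 : E) 1, G u ∂μ.toSphere) *
        ∫ r : Set.Ioi (0 : ℝ), (r : ℝ) ^ k * w r
          ∂Measure.volumeIoiPow (Module.finrank ℝ E - 1) := by
    intro G hG
    rw [← integral_prod_mul (fun u : Metric.sphere (0 : E) 1 => G u)
      (fun r : Set.Ioi (0 : ℝ) => (r : ℝ) ^ k * w r),
      ← μ.measurePreserving_homeomorphUnitSphereProd.integral_comp
        (Homeomorph.measurableEmbedding _),
      ← restrict_compl_singleton (μ := μ) 0,
      ← integral_subtype_comap (measurableSet_singleton _).compl fun x => G x * w ‖x‖,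
      restrict_compl_singleton]
    congr 1 with x
    have hx : 0 < ‖(x : E)‖ := norm_pos_iff.2 x.2
    simp only [homeomorphUnitSphereProd_apply_fst_coe, homeomorphUnitSphereProd_apply_snd_coe]
    rw [hG _ (inv_pos.2 hx), ← mul_assoc, mul_right_comm _ _ (‖(x : E)‖ ^ k), ← mul_pow,
      inv_mul_cancel₀ hx.ne', one_pow, one_mul]
  have hnorm : ∀ r : ℝ, 0 < r → ∀ x : E, ‖r • x‖ ^ k = r ^ k * ‖x‖ ^ k := fun r hr x => by
    rw [norm_smul, Real.norm_of_nonneg hr.le, mul_pow]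
  have : NeZero μ.toSphere := ⟨μ.toSphere_ne_zero⟩
  have hmass : μ.toSphere.real Set.univ ≠ 0 := measureReal_univ_ne_zero
  rw [hpolar F hF, hpolar (fun x => ‖x‖ ^ k) hnorm, average_eq]
  simp only [norm_eq_of_mem_sphere, one_pow, integral_const, smul_eq_mul, mul_one]
  field_simp

section StdGaussian

variable {E : Type*} [NormedAddCommGroup E] [InnerProductSpace ℝ E] [FiniteDimensional ℝ E]
  [MeasurableSpace E] [BorelSpace E]

theorem integral_stdGaussian_of_homogeneous [Nontrivial E] {F : E → ℝ} {k : ℕ}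
    (hF : ∀ r : ℝ, 0 < r → ∀ x, F (r • x) = r ^ k * F x) :
    ∫ x, F x ∂stdGaussian E = (∫ x, ‖x‖ ^ k ∂stdGaussian E) *
      ⨍ u : Metric.sphere (0 : E) 1, F u ∂(volume : Measure E).toSphere := by
  have hdensity : ∀ G : E → ℝ, ∫ x, G x ∂stdGaussian E = ∫ x, G x *
      ((2 * Real.pi) ^ (-(Module.finrank ℝ E / 2 : ℝ)) * Real.exp (-(1 / 2) * ‖x‖ ^ 2)) := by
    intro G
    rw [stdGaussian_eq_withDensity, integral_withDensity_eq_integral_toReal_smul (by fun_prop)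
      (by simp)]
    congr 1 with x
    rw [ENNReal.toReal_ofReal (by positivity), smul_eq_mul, mul_comm]
  rw [hdensity, hdensity, integral_mul_fun_norm_of_homogeneous volume hF fun r =>
    (2 * Real.pi) ^ (-(Module.finrank ℝ E / 2 : ℝ)) * Real.exp (-(1 / 2) * r ^ 2)]

instance isOpenPosMeasure_stdGaussian : (stdGaussian E).IsOpenPosMeasure := by
  rw [stdGaussian_eq_withDensity]
  refine (withDensity_absolutelyContinuous' (by fun_prop)
    (.of_forall fun x => ?_)).isOpenPosMeasure
  exact (ENNReal.ofReal_pos.2 (by positivity)).ne'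

theorem integral_norm_pow_stdGaussian_pos [Nontrivial E] (k : ℕ) :
    0 < ∫ x, ‖x‖ ^ k ∂stdGaussian E := by
  obtain ⟨x, hx⟩ := exists_ne (0 : E)
  refine integral_pos_of_integrable_nonneg_nonzero (x := x) (by fun_prop) ?_
    (fun y => by positivity) (by positivity)
  exact (IsGaussian.memLp_id (stdGaussian E) k (by simp)).integrable_norm_pow'

theorem integral_stdGaussian_eq_zero_of_odd {F : E → ℝ} (hF : Function.Odd F) :
    ∫ x, F x ∂stdGaussian E = 0 := by
  have hneg : MeasurePreserving (LinearIsometryEquiv.neg ℝ : E ≃ₗᵢ[ℝ] E) (stdGaussian E)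
      (stdGaussian E) := ⟨by fun_prop, stdGaussian_map _⟩
  have h := hneg.integral_comp (LinearIsometryEquiv.neg ℝ).toHomeomorph.measurableEmbedding F
  simp only [LinearIsometryEquiv.coe_neg, hF _, integral_neg] at h
  linarith

end StdGaussian

theorem eval_smul_of_isHomogeneous {R σ : Type*} [CommSemiring R] {f : MvPolynomial σ R} {k : ℕ}
    (hf : f.IsHomogeneous k) (r : R) (x : σ → R) :
    MvPolynomial.eval (r • x) f = r ^ k * MvPolynomial.eval x f := by
  rw [MvPolynomial.eval_eq, MvPolynomial.eval_eq, Finset.mul_sum]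
  refine Finset.sum_congr rfl fun α hα => ?_
  simp only [Pi.smul_apply, smul_eq_mul, mul_pow, Finset.prod_mul_distrib,
    Finset.prod_pow_eq_pow_sum]
  rw [hf.degree_eq_sum_deg_support hα, mul_left_comm]

section Sphere

variable {d : ℕ}

theorem continuous_polyValue (f : MvPolynomial (Fin d) ℝ) : Continuous (polyValue f) :=
  (MvPolynomial.continuous_eval f).comp (by fun_prop)

theorem polyValue_neg_of_isHomogeneous {f : MvPolynomial (Fin d) ℝ} {k : ℕ}
    (hf : f.IsHomogeneous k) (u : UnitSphere d) : polyValue f (-u) = (-1) ^ k * polyValue f u := by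
  rw [polyValue, polyValue, ← eval_smul_of_isHomogeneous hf]
  refine congrArg (fun x => MvPolynomial.eval x f) (funext fun i => ?_)
  simp

theorem polyValue_eq_sum_homogeneousComponent (f : MvPolynomial (Fin d) ℝ) (u : UnitSphere d) :
    polyValue f u = ∑ k ∈ Finset.range (f.totalDegree + 1),
      polyValue (MvPolynomial.homogeneousComponent k f) u := by
  simp only [polyValue]
  rw [← map_sum, MvPolynomial.sum_homogeneousComponent]

theorem polyValue_mul_sum_sq_pow (f : MvPolynomial (Fin d) ℝ) (m : ℕ) (u : UnitSphere d) :
    polyValue (f * (∑ i, MvPolynomial.X i ^ 2) ^ m) u = polyValue f u := by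
  have hu : ∑ i, (u : EuclideanSpace ℝ (Fin d)) i ^ 2 = 1 := by
    rw [← EuclideanSpace.real_norm_sq_eq, norm_eq_of_mem_sphere u, one_pow]
  simp [polyValue, hu]

variable [NeZero d]

instance isProbabilityMeasure_sphereMeasure : IsProbabilityMeasure (sphereMeasure d) :=
  have : NeZero (volume : Measure (EuclideanSpace ℝ (Fin d))).toSphere :=
    ⟨Measure.toSphere_ne_zero _⟩
  isProbabilityMeasureSMul

theorem integral_polyValue_eq_sum_homogeneousComponent (f : MvPolynomial (Fin d) ℝ) :
    ∫ u, polyValue f u ∂sphereMeasure d = ∑ k ∈ Finset.range (f.totalDegree + 1),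
      ∫ u, polyValue (MvPolynomial.homogeneousComponent k f) u ∂sphereMeasure d := by
  simp only [polyValue_eq_sum_homogeneousComponent f]
  exact integral_finsetSum _ fun k _ => (continuous_polyValue _).integrable_of_hasCompactSupport
    (HasCompactSupport.of_compactSpace _)

theorem integral_eval_stdGaussian_of_isHomogeneous {f : MvPolynomial (Fin d) ℝ} {k : ℕ}
    (hf : f.IsHomogeneous k) :
    ∫ x, MvPolynomial.eval x.ofLp f ∂stdGaussian (EuclideanSpace ℝ (Fin d)) =
      (∫ x, ‖x‖ ^ k ∂stdGaussian (EuclideanSpace ℝ (Fin d))) *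
        ∫ u, polyValue f u ∂sphereMeasure d :=
  integral_stdGaussian_of_homogeneous fun r _ x => eval_smul_of_isHomogeneous hf r x.ofLp

theorem integral_polyValue_eq_zero_of_odd {f : MvPolynomial (Fin d) ℝ} {k : ℕ}
    (hf : f.IsHomogeneous k) (hk : Odd k) : ∫ u, polyValue f u ∂sphereMeasure d = 0 := by
  have hodd : Function.Odd fun x : EuclideanSpace ℝ (Fin d) => MvPolynomial.eval x.ofLp f := by
    intro x
    simpa [hk.neg_one_pow] using eval_smul_of_isHomogeneous hf (-1) x.ofLp
  have hzero := integral_stdGaussian_eq_zero_of_odd hodd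
  rw [integral_eval_stdGaussian_of_isHomogeneous hf] at hzero
  exact (mul_eq_zero.1 hzero).resolve_left (integral_norm_pow_stdGaussian_pos k).ne'

theorem integral_eval_pi_gaussianReal_of_isHomogeneous {f : MvPolynomial (Fin d) ℝ} {k : ℕ}
    (hf : f.IsHomogeneous k) :
    ∫ x, MvPolynomial.eval x f ∂Measure.pi (fun _ => gaussianReal 0 1) =
      (∫ x, ‖x‖ ^ k ∂stdGaussian (EuclideanSpace ℝ (Fin d))) *
        ∫ u, polyValue f u ∂sphereMeasure d := by
  rw [← integral_eval_stdGaussian_of_isHomogeneous hf, ← map_pi_eq_stdGaussian,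
    ← MeasurableEquiv.coe_toLp,
    (MeasurableEquiv.toLp 2 (Fin d → ℝ)).measurableEmbedding.integral_map]
  rfl

end Sphere

section OrthogonalArray

variable {R ι A : Type*} [Fintype R] [Fintype A]

/-- The map `h`, which lists the rows of an array with columns `ι` and entries in `A`, is an
orthogonal array of strength `k`: in any `s ≤ k` columns, each of the `|A| ^ s` patterns appears in
the same proportion `1 / |A| ^ s` of the rows. The denominator is cleared. -/
def IsOrthogonalArray (k : ℕ) (h : R → ι → A) : Prop :=
  ∀ S : Finset ι, S.card ≤ k → ∀ y : S → A,
    Nat.card {r // S.restrict (h r) = y} * Fintype.card A ^ S.card = Fintype.card R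

namespace IsOrthogonalArray

variable {k : ℕ} {h : R → ι → A} {S : Finset ι} {M : Type*} [CommSemiring M]

theorem sum_comp_restrict [DecidableEq ι] (hh : IsOrthogonalArray k h) (hS : S.card ≤ k)
    (F : (S → A) → M) :
    (∑ r, F (S.restrict (h r))) * Fintype.card A ^ S.card = Fintype.card R * ∑ y, F y := by
  classical
  rw [← Finset.sum_fiberwise (g := fun r => S.restrict (h r)), Finset.sum_mul, Finset.mul_sum]
  refine Finset.sum_congr rfl fun y _ => ?_
  have hfiber : ∑ r with S.restrict (h r) = y, F (S.restrict (h r)) =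
      Nat.card {r // S.restrict (h r) = y} * F y := by
    rw [Finset.sum_congr rfl fun r hr => by rw [(Finset.mem_filter.1 hr).2], Finset.sum_const,
      nsmul_eq_mul, Nat.card_eq_fintype_card, Fintype.card_subtype]
  rw [hfiber, ← hh S hS y]
  push_cast
  ring

theorem sum_prod (hh : IsOrthogonalArray k h) (hS : S.card ≤ k) (φ : ι → A → M) :
    (∑ r, ∏ i ∈ S, φ i (h r i)) * Fintype.card A ^ S.card =
      Fintype.card R * ∏ i ∈ S, ∑ a, φ i a := by
  classical
  have hrow : ∀ r, ∏ i ∈ S, φ i (h r i) = ∏ i : S, φ i (S.restrict (h r) i) := fun r =>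
    (Finset.prod_coe_sort S fun i => φ i (h r i)).symm
  simp only [hrow]
  rw [hh.sum_comp_restrict hS fun y => ∏ i : S, φ i (y i),
    ← Fintype.prod_sum fun (i : S) a => φ i a, Finset.prod_coe_sort S fun i => ∑ a, φ i a]

theorem of_surjective_restrict {G : Type*} [AddGroup G] [Fintype G] [AddGroup A]
    (Φ : G →+ ι → A)
    (hΦ : ∀ S : Finset ι, S.card ≤ k → Function.Surjective fun g => S.restrict (Φ g)) :
    IsOrthogonalArray k Φ := by
  classical
  intro S hS y
  let ΦS : G →+ S → A := AddMonoidHom.mk' (fun g => S.restrict (Φ g)) fun a b => by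
    rw [map_add]
    rfl
  have hfiber : ∀ z : S → A, Finset.card {g | ΦS g = z} = Finset.card {g | ΦS g = y} :=
    fun z => AddMonoidHom.card_fiber_eq_of_mem_range ΦS (hΦ S hS z) (hΦ S hS y)
  have hcard := Finset.card_eq_sum_card_fiberwise (f := ΦS) (s := Finset.univ) (t := Finset.univ)
    fun _ _ => Finset.mem_univ _
  simp only [hfiber, Finset.sum_const, Finset.card_univ, Fintype.card_fun, Fintype.card_coe,
    smul_eq_mul] at hcard
  rw [hcard, mul_comm, Nat.card_eq_fintype_card, Fintype.card_subtype]
  rfl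

end IsOrthogonalArray

end OrthogonalArray

section TraceCode

variable {K F ι : Type*} [Field K] [Field F] [Algebra K F]

variable (K) in
/-- The code with words `i ↦ c + Tr (b₁ x i + b₂ (x i)² + ⋯ + bₙ (x i)ⁿ)`, for `c` in `K` and
`b₁, …, bₙ` in the extension `F`: the dual of a BCH code over `K`. Its words are the rows of an
orthogonal array of strength `n + 1`. -/
noncomputable def traceCode (n : ℕ) (x : ι → F) : K × (Fin n → F) →+ ι → K :=
  AddMonoidHom.mk' (fun c i => c.1 + ∑ j, Algebra.trace K F (c.2 j * x i ^ (j.1 + 1)))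
    fun a b => by
      ext i
      simp only [Prod.fst_add, Prod.snd_add, Pi.add_apply, add_mul, map_add,
        Finset.sum_add_distrib]
      ring

theorem traceCode_coeff_apply {P : F[X]} {n : ℕ} (hP : P.natDegree ≤ n) (x : ι → F) (i : ι) :
    traceCode K n x (Algebra.trace K F (P.coeff 0), fun j => P.coeff (j + 1)) i =
      Algebra.trace K F (P.eval (x i)) := by
  rw [Polynomial.eval_eq_sum_range' (Nat.lt_succ_of_le hP), Finset.sum_range_succ', map_add,
    map_sum, pow_zero, mul_one, add_comm,
    ← Fin.sum_univ_eq_sum_range fun j => Algebra.trace K F (P.coeff (j + 1) * x i ^ (j + 1))]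
  rfl

theorem isOrthogonalArray_traceCode [Fintype K] [Fintype F] (n : ℕ) {x : ι → F}
    (hx : Function.Injective x) : IsOrthogonalArray (n + 1) (traceCode K n x) := by
  classical
  refine .of_surjective_restrict _ fun S hS y => ?_
  choose Y hY using fun i : S => Algebra.trace_surjective K F (y i)
  have hinj : Set.InjOn (fun i : S => x i) (Finset.univ : Finset S) :=
    (hx.comp Subtype.val_injective).injOn
  set P := Lagrange.interpolate Finset.univ (fun i : S => x i) Y
  have hdeg : P.natDegree ≤ n := by
    have h : P.degree < (n + 1 : ℕ) :=
      (Lagrange.degree_interpolate_lt Y hinj).trans_le (by simpa using mod_cast hS)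
    exact natDegree_le_iff_degree_le.2 (Order.le_of_lt_succ h)
  refine ⟨(Algebra.trace K F (P.coeff 0), fun j => P.coeff (j + 1)), ?_⟩
  ext i
  change traceCode K n x _ i = y i
  rw [traceCode_coeff_apply hdeg, Lagrange.eval_interpolate_at_node Y hinj (Finset.mem_univ i), hY]

end TraceCode

theorem exists_isOrthogonalArray_zmod (p : ℕ) [Fact p.Prime] (n : ℕ) {d : ℕ} (hd : d ≠ 0) :
    ∃ (R : Type) (_ : Fintype R) (h : R → Fin d → ZMod p), IsOrthogonalArray (n + 1) h ∧
      0 < Fintype.card R ∧ Fintype.card R ≤ p * (p * d) ^ n := by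
  have hp : p.Prime := Fact.out
  set m := Nat.log p d + 1
  have : Fintype (GaloisField p m) := .ofFinite _
  have hcard : Fintype.card (GaloisField p m) = p ^ m := by
    rw [← Nat.card_eq_fintype_card, GaloisField.card p m (Nat.succ_ne_zero _)]
  obtain ⟨x⟩ : Nonempty (Fin d ↪ GaloisField p m) := by
    refine Function.Embedding.nonempty_of_card_le ?_
    rw [Fintype.card_fin, hcard]
    exact (Nat.lt_pow_succ_log_self hp.one_lt d).le
  refine ⟨ZMod p × (Fin n → GaloisField p m), inferInstance, traceCode (ZMod p) n x,
    isOrthogonalArray_traceCode n x.injective, Fintype.card_pos, ?_⟩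
  simp only [Fintype.card_prod, ZMod.card, Fintype.card_fun, Fintype.card_fin, hcard]
  gcongr
  rw [pow_succ, mul_comm]
  gcongr
  exact Nat.pow_log_le_self p hd

section Tensorization

variable {μ : Measure ℝ} {R ι A : Type*} [Fintype R] [Fintype A] [Nonempty A]

theorem IsOrthogonalArray.sum_prod_pow {t : ℕ} {g : A → ℝ}
    (hg : ∀ j ≤ t, ∑ a, g a ^ j = Fintype.card A * ∫ x, x ^ j ∂μ)
    {h : R → ι → A} (hh : IsOrthogonalArray t h) {α : ι →₀ ℕ} (hα : α.degree ≤ t) :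
    ∑ r, ∏ i ∈ α.support, g (h r i) ^ α i =
      Fintype.card R * ∏ i ∈ α.support, ∫ x, x ^ α i ∂μ := by
  have hsupport : α.support.card ≤ t := by
    refine le_trans ?_ hα
    rw [Finset.card_eq_sum_ones, Finsupp.degree_apply]
    exact Finset.sum_le_sum fun i hi => Nat.one_le_iff_ne_zero.2 (Finsupp.mem_support_iff.1 hi)
  have hsum := hh.sum_prod hsupport fun i a => g a ^ α i
  simp only [hg _ ((Finsupp.le_degree _ α).trans hα)] at hsum
  rw [Finset.prod_mul_distrib, Finset.prod_const, mul_left_comm, mul_comm] at hsum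
  exact mul_left_cancel₀ (pow_ne_zero _ (Nat.cast_ne_zero.2 Fintype.card_ne_zero)) hsum

variable [IsProbabilityMeasure μ] [Fintype ι]

theorem integral_prod_pow_pi (α : ι →₀ ℕ) :
    ∫ x, ∏ i, x i ^ α i ∂Measure.pi (fun _ : ι => μ) = ∏ i ∈ α.support, ∫ x, x ^ α i ∂μ := by
  rw [integral_fintype_prod_eq_prod (fun i x => x ^ α i)]
  refine (Finset.prod_subset (Finset.subset_univ _) fun i _ hi => ?_).symm
  simp [Finsupp.notMem_support_iff.1 hi]

theorem integral_eval_pi (hμ : ∀ j : ℕ, Integrable (fun x => x ^ j) μ) (f : MvPolynomial ι ℝ) :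
    ∫ x, MvPolynomial.eval x f ∂Measure.pi (fun _ : ι => μ) =
      ∑ α ∈ f.support, f.coeff α * ∏ i ∈ α.support, ∫ x, x ^ α i ∂μ := by
  simp only [MvPolynomial.eval_eq', ← integral_prod_pow_pi, ← integral_const_mul]
  exact integral_finsetSum _ fun α _ =>
    (Integrable.fintype_prod fun i => hμ (α i)).const_mul _

theorem IsOrthogonalArray.sum_eval_eq_integral_pi
    (hμ : ∀ j : ℕ, Integrable (fun x => x ^ j) μ) {t : ℕ} {g : A → ℝ}
    (hg : ∀ j ≤ t, ∑ a, g a ^ j = Fintype.card A * ∫ x, x ^ j ∂μ)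
    {h : R → ι → A} (hh : IsOrthogonalArray t h) {f : MvPolynomial ι ℝ} (hf : f.totalDegree ≤ t) :
    ∑ r, MvPolynomial.eval (fun i => g (h r i)) f =
      Fintype.card R * ∫ x, MvPolynomial.eval x f ∂Measure.pi (fun _ : ι => μ) := by
  rw [integral_eval_pi hμ]
  simp only [MvPolynomial.eval_eq]
  rw [Finset.sum_comm, Finset.mul_sum]
  refine Finset.sum_congr rfl fun α hα => ?_
  rw [← Finset.mul_sum, hh.sum_prod_pow hg ((MvPolynomial.le_totalDegree hα).trans hf),
    mul_left_comm]

end Tensorization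

theorem exists_rat_vectors_sum_eval_eq_integral_gaussian {t : ℕ} (ht : t ≠ 0) :
    ∃ p : ℕ, ∀ d : ℕ, d ≠ 0 → ∃ (R : Type) (_ : Fintype R) (q : R → Fin d → ℚ),
      0 < Fintype.card R ∧ Fintype.card R ≤ p * (p * d) ^ (t - 1) ∧
      ∀ f : MvPolynomial (Fin d) ℝ, f.totalDegree ≤ t →
        ∑ r, MvPolynomial.eval (fun i => (q r i : ℝ)) f =
          Fintype.card R * ∫ x, MvPolynomial.eval x f ∂Measure.pi (fun _ => gaussianReal 0 1) := by
  have : (gaussianReal 0 1).IsOpenPosMeasure :=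
    (gaussianReal_absolutelyContinuous' 0 one_ne_zero).isOpenPosMeasure
  have hrat : ∀ j : ℕ, ∃ q : ℚ, ∫ x, x ^ j ∂gaussianReal 0 1 = q := fun j => by
    obtain ⟨n, hn⟩ := exists_nat_eq_integral_pow_gaussianReal j
    exact ⟨n, by simpa using hn⟩
  obtain ⟨N, hN⟩ := exists_equal_weight_quadrature (integrable_pow_gaussianReal 1) hrat t
  obtain ⟨p, hNp, hp⟩ := Nat.exists_infinite_primes N
  have : Fact p.Prime := ⟨hp⟩
  obtain ⟨g, hg⟩ := hN (ZMod p) (by rwa [ZMod.card])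
  refine ⟨p, fun d hd => ?_⟩
  obtain ⟨R, hR, h, hh, hpos, hcard⟩ := exists_isOrthogonalArray_zmod p (t - 1) hd
  rw [Nat.sub_add_cancel (Nat.one_le_iff_ne_zero.2 ht)] at hh
  exact ⟨R, hR, fun r i => g (h r i), hpos, hcard, fun f hf =>
    hh.sum_eval_eq_integral_pi (integrable_pow_gaussianReal 1) hg hf⟩

theorem exists_norm_smul_sphere_eq {E : Type*} [NormedAddCommGroup E] [NormedSpace ℝ E]
    [Nontrivial E] (x : E) : ∃ u : Metric.sphere (0 : E) 1, ‖x‖ • (u : E) = x := by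
  rcases eq_or_ne x 0 with rfl | hx
  · obtain ⟨u, hu⟩ := (NormedSpace.sphere_nonempty (x := (0 : E))).2 zero_le_one
    exact ⟨⟨u, hu⟩, by simp⟩
  · refine ⟨⟨‖x‖⁻¹ • x, ?_⟩, smul_inv_smul₀ (norm_ne_zero_iff.2 hx) x⟩
    rw [mem_sphere_zero_iff_norm, norm_smul, norm_inv, norm_norm,
      inv_mul_cancel₀ (norm_ne_zero_iff.2 hx)]

section Designs

variable {d t : ℕ}

theorem IsUnweightedSphericalDesign.exists_weighted {X : Multiset (UnitSphere d)}
    (hX : IsUnweightedSphericalDesign t X) :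
    ∃ (Y : Finset (UnitSphere d)) (w : UnitSphere d → ℝ),
      IsWeightedSphericalDesign t Y w ∧ Y.card = {x | x ∈ X}.ncard := by
  classical
  have hcard : 0 < (Multiset.card X : ℝ) := by
    exact_mod_cast Multiset.card_pos.2 hX.1
  refine ⟨X.toFinset, fun x => X.count x / Multiset.card X, ⟨fun x hx => ?_, fun f hf => ?_⟩, ?_⟩
  · exact div_pos (by exact_mod_cast Multiset.count_pos.2 (Multiset.mem_toFinset.1 hx)) hcard
  · rw [← hX.2 f hf, Finset.sum_multiset_map_count, Finset.mul_sum]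
    refine Finset.sum_congr rfl fun x _ => ?_
    rw [nsmul_eq_mul]
    ring
  · rw [← Set.ncard_coe_finset]
    congr 1
    ext x
    simp

variable {R : Type*} [Fintype R] {s : ℕ} {A : ℝ} {v : R → EuclideanSpace ℝ (Fin d)}
  {u : R → UnitSphere d}

theorem sum_norm_pow_mul_polyValue_of_isHomogeneous
    (hu : ∀ r, ‖v r‖ • (u r : EuclideanSpace ℝ (Fin d)) = v r)
    (hv : ∀ f : MvPolynomial (Fin d) ℝ, f.IsHomogeneous (2 * s) →
      ∑ r, MvPolynomial.eval (v r).ofLp f = A * ∫ x, polyValue f x ∂sphereMeasure d)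
    {f : MvPolynomial (Fin d) ℝ} {j : ℕ} (hf : f.IsHomogeneous (2 * j)) (hj : j ≤ s) :
    ∑ r, ‖v r‖ ^ (2 * s) * polyValue f (u r) = A * ∫ x, polyValue f x ∂sphereMeasure d := by
  set g := f * (∑ i, MvPolynomial.X i ^ 2) ^ (s - j)
  have hsq : (∑ i : Fin d, MvPolynomial.X i ^ 2 : MvPolynomial (Fin d) ℝ).IsHomogeneous 2 :=
    MvPolynomial.IsHomogeneous.sum _ _ _ fun i _ => MvPolynomial.isHomogeneous_X_pow i 2
  have hg : g.IsHomogeneous (2 * s) := by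
    rw [← Nat.add_sub_cancel' hj, mul_add]
    simpa using hf.mul (hsq.pow (s - j))
  calc ∑ r, ‖v r‖ ^ (2 * s) * polyValue f (u r)
      = ∑ r, MvPolynomial.eval (v r).ofLp g := by
        refine Finset.sum_congr rfl fun r _ => ?_
        conv_rhs => rw [← hu r]
        rw [← polyValue_mul_sum_sq_pow f (s - j)]
        exact (eval_smul_of_isHomogeneous hg _ _).symm
    _ = A * ∫ x, polyValue f x ∂sphereMeasure d := by
        rw [hv g hg]
        simp only [g, polyValue_mul_sum_sq_pow]

variable [NeZero d]

theorem exists_isUnweightedSphericalDesign_of_sum_mul_polyValue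
    (n : R → ℕ) {B : ℝ} (hB : B ≠ 0)
    (h : ∀ f : MvPolynomial (Fin d) ℝ, f.totalDegree ≤ t →
      ∑ r, n r * polyValue f (u r) = B * ∫ x, polyValue f x ∂sphereMeasure d) :
    ∃ X : Multiset (UnitSphere d), IsUnweightedSphericalDesign t X ∧
      {x | x ∈ X}.ncard ≤ Fintype.card R := by
  classical
  set X : Multiset (UnitSphere d) := ∑ r, Multiset.replicate (n r) (u r)
  have hsum : ∀ F : UnitSphere d → ℝ, (X.map F).sum = ∑ r, n r * F (u r) := fun F => by
    rw [← Multiset.coe_mapAddMonoidHom, map_sum, ← Multiset.coe_sumAddMonoidHom, map_sum]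
    simp
  have hcard : (Multiset.card X : ℝ) = B := by
    simpa [polyValue, X] using h 1 (by simp)
  refine ⟨X, ⟨fun hX => hB ?_, fun f hf => ?_⟩, ?_⟩
  · rw [← hcard, hX, Multiset.card_zero, Nat.cast_zero]
  · rw [hsum, h f hf, hcard, one_div, inv_mul_cancel_left₀ hB]
  · have hsub : {x | x ∈ X} ⊆ Set.range u := fun x hx => by
      obtain ⟨r, -, hr⟩ := Multiset.mem_sum.1 hx
      exact ⟨r, (Multiset.eq_of_mem_replicate hr).symm⟩
    refine (Set.ncard_le_ncard hsub (Set.finite_range u)).trans ?_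
    rw [← Nat.card_coe_set_eq, ← Nat.card_eq_fintype_card]
    exact Finite.card_range_le u

theorem sum_norm_pow_mul_polyValue_add_polyValue_neg
    (hu : ∀ r, ‖v r‖ • (u r : EuclideanSpace ℝ (Fin d)) = v r)
    (hv : ∀ f : MvPolynomial (Fin d) ℝ, f.IsHomogeneous (2 * s) →
      ∑ r, MvPolynomial.eval (v r).ofLp f = A * ∫ x, polyValue f x ∂sphereMeasure d)
    {f : MvPolynomial (Fin d) ℝ} (hf : f.totalDegree ≤ 2 * s + 1) :
    ∑ r, ‖v r‖ ^ (2 * s) * (polyValue f (u r) + polyValue f (-u r)) =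
      2 * A * ∫ x, polyValue f x ∂sphereMeasure d := by
  rw [integral_polyValue_eq_sum_homogeneousComponent, Finset.mul_sum]
  simp only [polyValue_eq_sum_homogeneousComponent f, ← Finset.sum_add_distrib, Finset.mul_sum]
  rw [Finset.sum_comm]
  refine Finset.sum_congr rfl fun k hk => ?_
  have hk : k < f.totalDegree + 1 := Finset.mem_range.1 hk
  have hhom := MvPolynomial.homogeneousComponent_isHomogeneous k f
  rcases Nat.even_or_odd' k with ⟨j, rfl | rfl⟩
  · simp only [polyValue_neg_of_isHomogeneous hhom, Even.neg_one_pow (even_two_mul j), one_mul,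
      ← two_mul, mul_left_comm _ (2 : ℝ)]
    rw [← Finset.mul_sum,
      sum_norm_pow_mul_polyValue_of_isHomogeneous hu hv hhom (by omega), mul_assoc]
  · have hodd : Odd (2 * j + 1) := odd_two_mul_add_one j
    simp [polyValue_neg_of_isHomogeneous hhom, hodd.neg_one_pow,
      integral_polyValue_eq_zero_of_odd hhom hodd]

theorem exists_isUnweightedSphericalDesign_of_rat_vectors (ht : t ≤ 2 * s + 1) (hA : A ≠ 0)
    (q : R → Fin d → ℚ)
    (hq : ∀ f : MvPolynomial (Fin d) ℝ, f.IsHomogeneous (2 * s) →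
      ∑ r, MvPolynomial.eval (fun i => (q r i : ℝ)) f =
        A * ∫ x, polyValue f x ∂sphereMeasure d) :
    ∃ X : Multiset (UnitSphere d), IsUnweightedSphericalDesign t X ∧
      {x | x ∈ X}.ncard ≤ 2 * Fintype.card R := by
  set v : R → EuclideanSpace ℝ (Fin d) := fun r => WithLp.toLp 2 fun i => (q r i : ℝ)
  choose u hu using fun r => exists_norm_smul_sphere_eq (v r)
  have hnorm : ∀ r, ‖v r‖ ^ (2 * s) = ((∑ i, q r i ^ 2) ^ s : ℚ) := fun r => by
    rw [pow_mul, EuclideanSpace.real_norm_sq_eq]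
    push_cast
    rfl
  obtain ⟨D, hD, hint⟩ := exists_nat_mul_eq_intCast fun r => (∑ i, q r i ^ 2) ^ s
  have hmult : ∀ r, ∃ n : ℕ, D * ‖v r‖ ^ (2 * s) = n := fun r => by
    obtain ⟨z, hz⟩ := hint r
    have hz0 : 0 ≤ z := by
      rw [← Int.cast_nonneg_iff (R := ℚ), ← hz]
      positivity
    lift z to ℕ using hz0
    exact ⟨z, by rw [hnorm]; exact_mod_cast hz⟩
  choose n hn using hmult
  obtain ⟨X, hX, hcard⟩ := exists_isUnweightedSphericalDesign_of_sum_mul_polyValue (t := t)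
    (u := Sum.elim u (-u)) (Sum.elim n n) (B := D * (2 * A)) (by simpa using ⟨hD, hA⟩)
    fun f hf => by
      rw [mul_assoc, ← sum_norm_pow_mul_polyValue_add_polyValue_neg hu hq (hf.trans ht),
        Finset.mul_sum, Fintype.sum_sum_type]
      simp only [Sum.elim_inl, Sum.elim_inr, Pi.neg_apply, ← Finset.sum_add_distrib, ← mul_add,
        ← mul_assoc, hn]
  exact ⟨X, hX, by simpa [two_mul] using hcard⟩

end Designs

end

theorem mainTheorem3 (t : ℕ) (ht : 1 ≤ t) :
    ∃ C : ℝ, ∀ d : ℕ, 1 ≤ d →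
      (∃ (X : Finset (UnitSphere d)) (w : UnitSphere d → ℝ),
        IsWeightedSphericalDesign t X w ∧ (X.card : ℝ) ≤ C * (d : ℝ) ^ (t - 1)) ∧
      (∃ X : Multiset (UnitSphere d),
        IsUnweightedSphericalDesign t X ∧
          ({x | x ∈ X}.ncard : ℝ) ≤ C * (d : ℝ) ^ (t - 1)) := by
  have ht0 : t ≠ 0 := Nat.one_le_iff_ne_zero.1 ht
  obtain ⟨p, hp⟩ := exists_rat_vectors_sum_eval_eq_integral_gaussian ht0
  refine ⟨2 * p ^ t, fun d hd => ?_⟩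
  have : NeZero d := ⟨Nat.one_le_iff_ne_zero.1 hd⟩
  obtain ⟨R, _, q, hR, hcardR, hq⟩ := hp d (NeZero.ne d)
  have hmoment := integral_norm_pow_stdGaussian_pos (E := EuclideanSpace ℝ (Fin d)) (2 * (t / 2))
  obtain ⟨X, hX, hcardX⟩ := exists_isUnweightedSphericalDesign_of_rat_vectors
    (t := t) (s := t / 2) (by omega) (mul_pos (Nat.cast_pos.2 hR) hmoment).ne' q fun f hf => by
      rw [hq f (hf.totalDegree_le.trans (Nat.mul_div_le t 2)),
        integral_eval_pi_gaussianReal_of_isHomogeneous hf, mul_assoc]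
  have hbound : ({x | x ∈ X}.ncard : ℝ) ≤ 2 * p ^ t * (d : ℝ) ^ (t - 1) := by
    have h : {x | x ∈ X}.ncard ≤ 2 * p ^ t * d ^ (t - 1) := by
      refine hcardX.trans ((Nat.mul_le_mul_left 2 hcardR).trans_eq ?_)
      rw [mul_pow, ← mul_assoc p, mul_pow_sub_one ht0, mul_assoc]
    exact_mod_cast h
  obtain ⟨Y, w, hY, hcardY⟩ := hX.exists_weighted
  exact ⟨⟨Y, w, hY, by rwa [hcardY]⟩, X, hX, hbound⟩
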